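/- Let $X$ be a real or complex vector space with an F-norm $\|\cdot\|$, that is, a function $\|\cdot\|:X\to[0,\infty)$ such that $\|x\|=0$ if and only if $x=0$, $\|\alpha x\|=\|x\|$ for all scalars $\alpha$ with $|\alpha|=1$, $\|x+y\|\le\|x\|+\|y\|$, and scalar multiplication is jointly continuous for the metric $d(x,y)=\|x-y\|$. Assume that $X$ is complete for this metric (so that $X$ is a Fréchet space; local convexity is not assumed) and that $X$ is locally bounded: some neighbourhood $U$ of $0$ is bounded, i.e. for every neighbourhood $W$ of $0$ there is $r>0$ with $U\subseteq \alpha W$ for all scalars $\alpha$ with $|\alpha|\ge r$. Let $\{V_n\}$ be a sequence of linear subspaces of $X$ such that $\overline{V_n}\subsetneq V_{n+1}$ for every $n$. Let $(e_n)$ be a nonincreasing sequence of positive numbers tending to $0$. Then there exist $x\in X$ and $n_0\in\mathbb N$ such that for all $n\ge n_0$ $$\frac{e_n}{3}\le \operatorname{dist}(x,V_n)\le 3e_n,\qquad\text{where } \operatorname{dist}(x,V_n)=\inf_{v\in V_n}\|x-v\|.$$ -/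

import Mathlib

open Filter Topology

/-- The norm of the additive group `X` is an F-norm on the real or complex vector space `X`, and `X`
with the metric `‖x - y‖` is a metric linear space. The class `NormedAddCommGroup X` supplies
`‖x‖ = 0 ↔ x = 0`, the triangle inequality and the metric `dist x y = ‖x - y‖` (addition is then
continuous); here we add invariance under scalars of modulus one and the joint continuity of the
scalar multiplication. No homogeneity is required (in general `X` is not a `NormedSpace`). -/
class FNormedSpace (𝕜 X : Type*) [RCLike 𝕜] [NormedAddCommGroup X] [Module 𝕜 X] : Prop
    extends ContinuousSMul 𝕜 X where
  norm_smul_of_norm_eq_one : ∀ (a : 𝕜) (x : X), ‖a‖ = 1 → ‖a • x‖ = ‖x‖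

/-- A Fréchet space: a metric linear space that is complete for the F-norm giving the topology
(local convexity is not part of the notion). -/
class FrechetFSpace (𝕜 X : Type*) [RCLike 𝕜] [NormedAddCommGroup X] [Module 𝕜 X] : Prop
    extends FNormedSpace 𝕜 X, CompleteSpace X

/-- `X` is locally bounded: some neighbourhood of zero is bounded in the sense of topological
vector spaces, that is, absorbed by every neighbourhood of zero. -/
def IsLocallyBounded (𝕜 X : Type*) [RCLike 𝕜] [NormedAddCommGroup X] [Module 𝕜 X] : Prop :=
  ∃ U ∈ 𝓝 (0 : X), Bornology.IsVonNBounded 𝕜 U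

/-! Take x = ∑ yᵢ at scales ρᵢ = c/4ⁱ, with yᵢ barely longer than its distance to V_{Mᵢ}, where Mᵢ
is the last index with e > ρᵢ₊₁. If ρⱼ₊₁ < eₙ ≤ ρⱼ, the terms before yⱼ lie in Vₙ ⊆ V_{Mⱼ} and the
later ones are small, so dist(x, Vₙ) is comparable to ρⱼ. Local boundedness supplies such yᵢ at
every small scale. -/

/-- If the ball of radius `δ` is von Neumann bounded, every point outside the closure of a subspace
has a nonnegative real multiple at distance at least `δ` from that subspace. -/
theorem exists_le_infDist_smul {𝕜 X : Type*} [RCLike 𝕜] [NormedAddCommGroup X] [Module 𝕜 X]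
    [ContinuousSMul 𝕜 X] {U : Set X} (hU : Bornology.IsVonNBounded 𝕜 U) {δ : ℝ}
    (hδ : Metric.ball (0 : X) δ ⊆ U) (W : Submodule 𝕜 X) {w : X}
    (hw : w ∉ closure (W : Set X)) :
    ∃ t : ℝ, 0 ≤ t ∧ δ ≤ Metric.infDist ((t : 𝕜) • w) (W : Set X) := by
  by_contra! h
  have hne : (W : Set X).Nonempty := ⟨0, W.zero_mem⟩
  have hv (n : ℕ) : ∃ v ∈ W, dist (((n + 1 : ℝ) : 𝕜) • w) v < δ :=
    (Metric.infDist_lt_iff hne).1 (h (n + 1) (by positivity))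
  choose v hvW hvδ using hv
  apply hw
  have hε : Tendsto (fun n : ℕ ↦ (((n + 1 : ℝ)⁻¹ : ℝ) : 𝕜)) atTop (𝓝 0) := by
    have h1 : Tendsto (fun n : ℕ ↦ (n + 1 : ℝ)⁻¹) atTop (𝓝 0) := by
      simpa using tendsto_one_div_add_atTop_nhds_zero_nat (𝕜 := ℝ)
    have h2 := ((RCLike.continuous_ofReal (K := 𝕜)).tendsto 0).comp h1
    rwa [RCLike.ofReal_zero] at h2
  -- The errors (n+1)w - vₙ stay in the bounded set `U`, so dividing by n+1 sends them to 0 and puts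
  -- w in the closure of W.
  have hlim := hU.smul_tendsto_zero (x := fun n : ℕ ↦ ((n + 1 : ℝ) : 𝕜) • w - v n)
    (.of_forall fun n ↦ hδ (by rw [mem_ball_zero_iff, ← dist_eq_norm]; exact hvδ n)) hε
  have hlim' := hlim.const_sub w
  rw [sub_zero] at hlim'
  refine mem_closure_of_tendsto hlim' (.of_forall fun n ↦ ?_)
  have h0 : ((n + 1 : ℝ) : 𝕜) ≠ 0 := by
    exact_mod_cast (by positivity : (n + 1 : ℝ) ≠ 0)
  have : w - ((((n + 1 : ℝ)⁻¹ : ℝ) : 𝕜)) • (((n + 1 : ℝ) : 𝕜) • w - v n) =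
      (((n + 1 : ℝ)⁻¹ : ℝ) : 𝕜) • v n := by
    rw [smul_sub, smul_smul, RCLike.ofReal_inv, inv_mul_cancel₀ h0, one_smul, sub_sub_cancel]
  simp only [Pi.smul_apply', this]
  exact W.smul_mem _ (hvW n)

/-- In a locally bounded space, for small `s < r`, every strict inclusion `closure W ⊂ W'` admits
an element of `W'` of norm less than `r` whose distance to `W` is at least `s`. -/
theorem IsLocallyBounded.exists_norm_lt_le_infDist {𝕜 X : Type*} [RCLike 𝕜]
    [NormedAddCommGroup X] [Module 𝕜 X] [ContinuousSMul 𝕜 X] (hX : IsLocallyBounded 𝕜 X) :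
    ∃ δ > 0, ∀ s r : ℝ, 0 ≤ s → s < r → s ≤ δ → ∀ W W' : Submodule 𝕜 X,
      closure (W : Set X) ⊂ (W' : Set X) → ∃ y ∈ W', ‖y‖ < r ∧ ∀ v ∈ W, s ≤ ‖y - v‖ := by
  obtain ⟨U, hU0, hU⟩ := hX
  obtain ⟨δ, hδ, hball⟩ := Metric.mem_nhds_iff.1 hU0
  refine ⟨δ, hδ, fun s r hs hsr hsδ W W' hWW' ↦ ?_⟩
  obtain ⟨w, hwW', hw⟩ := Set.exists_of_ssubset hWW'
  obtain ⟨t, ht, hδt⟩ := exists_le_infDist_smul hU hball W hw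
  have hcont : Continuous fun t : ℝ ↦ Metric.infDist ((t : 𝕜) • w) (W : Set X) :=
    (Metric.continuous_infDist_pt _).comp
      ((RCLike.continuous_ofReal (K := 𝕜)).smul continuous_const)
  have h0 : Metric.infDist (((0 : ℝ) : 𝕜) • w) (W : Set X) = 0 := by
    rw [RCLike.ofReal_zero, zero_smul]
    exact Metric.infDist_zero_of_mem W.zero_mem
  -- Without homogeneity, the distance s is reached by continuity along the ray rather than by
  -- rescaling.
  obtain ⟨u, -, hu⟩ := intermediate_value_Icc ht hcont.continuousOn
    (show s ∈ Set.Icc _ _ from ⟨h0.le.trans hs, hsδ.trans hδt⟩)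
  replace hu : Metric.infDist ((u : 𝕜) • w) (W : Set X) = s := hu
  obtain ⟨v, hv, hvr⟩ := (Metric.infDist_lt_iff ⟨0, W.zero_mem⟩).1 (hu.trans_lt hsr)
  refine ⟨(u : 𝕜) • w - v, W'.sub_mem (W'.smul_mem _ hwW')
    (hWW'.subset (subset_closure hv)), by rwa [← dist_eq_norm], fun v' hv' ↦ ?_⟩
  rw [sub_sub, ← dist_eq_norm, ← hu]
  exact Metric.infDist_le_dist_of_mem (W.add_mem hv hv')

theorem theorem2p25 {𝕜 X : Type*} [RCLike 𝕜] [NormedAddCommGroup X] [Module 𝕜 X]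
    [FrechetFSpace 𝕜 X] (hX : IsLocallyBounded 𝕜 X)
    (V : ℕ → Submodule 𝕜 X)
    (hV : ∀ n, closure (V n : Set X) ⊂ (V (n + 1) : Set X))
    (e : ℕ → ℝ) (he_pos : ∀ n, 0 < e n) (he_anti : Antitone e)
    (he_lim : Tendsto e atTop (𝓝 0)) :
    ∃ (x : X) (n₀ : ℕ), ∀ n, n₀ ≤ n →
      e n / 3 ≤ Metric.infDist x (V n : Set X) ∧ Metric.infDist x (V n : Set X) ≤ 3 * e n := by
  have : CompleteSpace X := FrechetFSpace.toCompleteSpace 𝕜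
  have hVmono : Monotone V :=
    monotone_nat_of_le_succ fun n ↦ subset_closure.trans (hV n).subset
  obtain ⟨δ, hδ, hstep⟩ := hX.exists_norm_lt_le_infDist
  -- The bound by δ makes `hstep` applicable at every scale; the bound by e 0 makes each Mᵢ exist.
  set c : ℝ := min δ (e 0) with hc
  have hc0 : 0 < c := lt_min hδ (he_pos 0)
  set ρ : ℕ → ℝ := fun i ↦ c * (1 / 4) ^ i with hρ
  have hρ0 (i) : 0 < ρ i := by positivity
  have hρs (i) : ρ (i + 1) = ρ i / 4 := by simp only [hρ, pow_succ]; ring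
  have hρanti : Antitone ρ := antitone_nat_of_succ_le fun i ↦ by
    rw [hρs]; linarith [hρ0 i]
  have hρc (i) : ρ i ≤ c := by simpa [hρ] using hρanti (Nat.zero_le i)
  -- the last index at which `e` exceeds the next scale
  have hM (i) : ∃ M, ρ (i + 1) < e M ∧ e (M + 1) ≤ ρ (i + 1) := by
    have hex : ∃ n, e n ≤ ρ (i + 1) := (he_lim.eventually_le_const (hρ0 _)).exists
    have h0 : ρ (i + 1) < e 0 := by
      linarith [hρs i, hρ0 i, hρc i, min_le_right δ (e 0)]
    obtain ⟨M, hM⟩ : ∃ M, Nat.find hex = M + 1 := by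
      refine Nat.exists_eq_succ_of_ne_zero fun h ↦ ?_
      have := Nat.find_spec hex
      rw [h] at this
      exact h0.not_ge this
    exact ⟨M, not_le.1 (Nat.find_min hex (by omega)), hM ▸ Nat.find_spec hex⟩
  choose M hM1 hM2 using hM
  -- The terms after yⱼ sum to at most 3/16 ρⱼ. Then 9/16 + 3/16 = 3/4 gives the upper bound 3ρⱼ₊₁,
  -- and 25/48 - 3/16 = 1/3 gives the lower bound ρⱼ/3.
  have hy (i) : ∃ y ∈ V (M i + 1), ‖y‖ < 9 / 16 * ρ i ∧
      ∀ v ∈ V (M i), 25 / 48 * ρ i ≤ ‖y - v‖ :=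
    hstep _ _ (by linarith [hρ0 i]) (by linarith [hρ0 i])
      (by linarith [hρ0 i, hρc i, min_le_left δ (e 0)]) _ _ (hV _)
  choose y hyV hyn hyd using hy
  have htail (k) : HasSum (fun i ↦ 9 / 16 * ρ (i + k)) (3 / 4 * ρ k) := by
    have := (hasSum_geometric_of_lt_one (r := (1 / 4 : ℝ)) (by norm_num) (by norm_num)).mul_left
      (9 / 16 * ρ k)
    have h1 : (fun i ↦ 9 / 16 * ρ (i + k)) = fun i ↦ 9 / 16 * ρ k * (1 / 4) ^ i := by
      funext i
      simp only [hρ, pow_add]; ring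
    have h2 : 3 / 4 * ρ k = 9 / 16 * ρ k * (1 - 1 / 4)⁻¹ := by ring
    rwa [h1, h2]
  have hsum : Summable y :=
    Summable.of_norm_bounded (htail 0).summable fun i ↦ (hyn i).le
  have htailn (k) : ‖∑' i, y (i + k)‖ ≤ 3 / 4 * ρ k :=
    tsum_of_norm_bounded (htail k) fun i ↦ (hyn _).le
  obtain ⟨n₀, hn₀⟩ := (he_lim.eventually_le_const hc0).exists
  refine ⟨∑' i, y i, n₀, fun n hn ↦ ?_⟩
  obtain ⟨j, hj1, hj2⟩ : ∃ j, ρ (j + 1) < e n ∧ e n ≤ ρ j := by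
    obtain ⟨j, h1, h2⟩ := exists_nat_pow_near_of_lt_one (x := e n / c) (y := (1 / 4 : ℝ))
      (div_pos (he_pos n) hc0) ((div_le_one hc0).2 ((he_anti hn).trans hn₀))
      (by norm_num) (by norm_num)
    exact ⟨j, (lt_div_iff₀' hc0).1 h1, (div_le_iff₀' hc0).1 h2⟩
  have hhead : ∑ i ∈ Finset.range j, y i ∈ V n := by
    refine Submodule.sum_mem _ fun i hi ↦ hVmono ?_ (hyV i)
    -- Otherwise n ≤ Mᵢ, so e(Mᵢ) ≤ eₙ ≤ ρⱼ ≤ ρᵢ₊₁, against the choice of Mᵢ.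
    by_contra! hlt
    have h1 := he_anti (Nat.lt_succ_iff.1 hlt)
    have h2 := hρanti (Nat.succ_le_of_lt (Finset.mem_range.1 hi))
    exact absurd (hM1 i) (by simp only [Nat.succ_eq_add_one] at h2; linarith)
  have hnM : n ≤ M j := by
    by_contra! hlt
    linarith [he_anti (Nat.succ_le_of_lt hlt), hM2 j]
  set h := ∑ i ∈ Finset.range j, y i
  set z := ∑' i, y (i + (j + 1))
  have hx : ∑' i, y i = h + y j + z := by
    rw [← hsum.sum_add_tsum_nat_add (j + 1), Finset.sum_range_succ]
  have hz : ‖z‖ ≤ 3 / 16 * ρ j := by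
    linarith [htailn (j + 1), hρs j]
  constructor
  · refine (Metric.le_infDist ⟨0, (V n).zero_mem⟩).2 fun v hv ↦ ?_
    have h1 := hyd j (v - h) (hVmono hnM ((V n).sub_mem hv hhead))
    have h2 : y j - (v - h) = (∑' i, y i - v) - z := by rw [hx]; abel
    rw [h2] at h1
    rw [dist_eq_norm]
    linarith [norm_sub_le (∑' i, y i - v) z]
  · refine (Metric.infDist_le_dist_of_mem hhead).trans ?_
    have h2 : ∑' i, y i - h = y j + z := by rw [hx]; abel
    rw [dist_eq_norm, h2]
    linarith [norm_add_le (y j) z, hyn j, hρs j]
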